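/- Let $n\ge 2$ and $k\ge 2$ be integers, $\alpha\in\mathbb R$ and $p>1$. Let $C^k_{c,r}(\mathbb R^n\setminus\{0\})$ be the space of radially symmetric real functions in $C^k_c(\mathbb R^n\setminus\{0\})$, and let $\nabla^k=\Delta^m$ if $k=2m$ is even, $\nabla^k=\nabla\Delta^m$ if $k=2m+1$ is odd. Put $$H_\alpha=\frac{n+\alpha}{p}-1,\qquad \gamma_{\alpha,h}=\Big(\frac{n+\alpha}{p}-h\Big)\Big(n-2+h-\frac{n+\alpha}{p}\Big)\quad(h\in\mathbb N).$$ Then, for every $u\in C^k_{c,r}(\mathbb R^n\setminus\{0\})$, the integrals below are finite, and the best (that is, the largest) real constant $c$ such that $$\int_{\mathbb R^n}|x|^\alpha|\nabla^k u|^p\,dx\;\ge\; c\int_{\mathbb R^n}|x|^{\alpha-kp}|u|^p\,dx\qquad\text{for all }u\in C^k_{c,r}(\mathbb R^n\setminus\{0\})$$ exists and is equal to $$c_{\alpha,k,p}=\begin{cases}\displaystyle\prod_{h=1}^m|\gamma_{\alpha,2h}|^p&\text{if }k=2m\text{ is even},\\[2mm]\displaystyle|H_\alpha|^p\prod_{h=1}^m|\gamma_{\alpha,2h+1}|^p&\text{if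 }k=2m+1\text{ is odd}.\end{cases}$$ -/

import Mathlib

open MeasureTheory

noncomputable section

/-- The space of radially symmetric functions in `C^k_c(ℝⁿ ∖ {0})`. A function on `ℝⁿ ∖ {0}` with
compact support there is identified with its extension by zero to `ℝⁿ`. -/
def radialCc (n k : ℕ) : Set (EuclideanSpace ℝ (Fin n) → ℝ) :=
  {u | ContDiff ℝ (k : ℕ∞) u ∧ HasCompactSupport u ∧ (0 : EuclideanSpace ℝ (Fin n)) ∉ tsupport u ∧
    ∀ x y, ‖x‖ = ‖y‖ → u x = u y}

/-- The pointwise norm `|∇^k u|(x)`, where `∇^k = Δ^m` if `k = 2m`, and `∇^k = ∇ Δ^m` if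
`k = 2m + 1`. -/
def nablaPowNorm {n : ℕ} (k : ℕ) (u : EuclideanSpace ℝ (Fin n) → ℝ)
    (x : EuclideanSpace ℝ (Fin n)) : ℝ :=
  if Even k then |Laplacian.laplacian^[k / 2] u x|
  else ‖gradient (Laplacian.laplacian^[k / 2] u) x‖

/-- The integrand `|x|^α |∇^k u(x)|^p`. -/
def rellichLHS {n : ℕ} (α p : ℝ) (k : ℕ) (u : EuclideanSpace ℝ (Fin n) → ℝ)
    (x : EuclideanSpace ℝ (Fin n)) : ℝ :=
  ‖x‖ ^ α * nablaPowNorm k u x ^ p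

/-- The integrand `|x|^(α - kp) |u(x)|^p`. -/
def rellichRHS {n : ℕ} (α p : ℝ) (k : ℕ) (u : EuclideanSpace ℝ (Fin n) → ℝ)
    (x : EuclideanSpace ℝ (Fin n)) : ℝ :=
  ‖x‖ ^ (α - k * p) * |u x| ^ p

/-- `c` is the best constant in
`∫ |x|^α |∇^k u|^p dx ≥ c ∫ |x|^(α - kp) |u|^p dx` over all radial `u ∈ C^k_c(ℝⁿ ∖ {0})`:
it is the largest real number for which the inequality holds. -/
def IsBestRellichConst (n k : ℕ) (α p c : ℝ) : Prop :=
  IsGreatest {c : ℝ | ∀ u ∈ radialCc n k,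
    c * (∫ x, rellichRHS α p k u x) ≤ ∫ x, rellichLHS α p k u x} c

/-- `H_α = (n + α)/p - 1`. -/
def hardyH (n : ℕ) (α p : ℝ) : ℝ := (n + α) / p - 1

/-- `γ_{α,h} = ((n + α)/p - h) (n - 2 + h - (n + α)/p)`. -/
def rellichGamma (n : ℕ) (α p : ℝ) (h : ℕ) : ℝ :=
  ((n + α) / p - h) * (n - 2 + h - (n + α) / p)

end

/-! In the logarithmic variable t = log|x| the problem has constant coefficients. Write u = |x|^{-β}
g(log|x|) with β = (n+α)/p - k. Each Laplacian then acts on g as a product of two operators D - l,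
and a final gradient adds one more (`nablaPowNorm_of_radial`). This β makes both weights equal to
|x|^{-n}, which cancels the Jacobian of polar coordinates, so both integrals become flat L^p
integrals over ℝ with the same factor (`radial_integrable_iff`).

It remains to bound ∏(D - l) from below in L^p(ℝ). Convexity gives ‖(D - l)v‖_p ≥ |l| ‖v‖_p, and
iteration gives |∏ l| (`hardy_firstOrderProd`). This is sharp: on g(st) with s → 0 the derivatives
become negligible and only multiplication by ±∏ l survives (`le_of_firstOrderProd_le`). The product
of the l is, up to sign, the stated constant before taking the p-th power. -/

/-! ### Hardy inequalities for first-order operators on the line -/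

/-- The composition of the operators `g ↦ g' - l g`, for `l` in the given list. -/
noncomputable def firstOrderProd : List ℝ → (ℝ → ℝ) → ℝ → ℝ
  | [], g => g
  | l :: L, g => fun t => deriv (firstOrderProd L g) t - l * firstOrderProd L g t

theorem contDiff_firstOrderProd (L : List ℝ) (m : ℕ) {g : ℝ → ℝ}
    (hg : ContDiff ℝ ((m + L.length : ℕ) : ℕ∞) g) :
    ContDiff ℝ (m : ℕ∞) (firstOrderProd L g) := by
  induction L generalizing m with
  | nil => simpa [firstOrderProd] using hg
  | cons l L ih =>
    have h := ih (m + 1) (by convert hg using 3; simp; ring)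
    have h' : ContDiff ℝ ((m : ℕ∞) + 1 : WithTop ℕ∞) (firstOrderProd L g) := by
      simpa using h
    have h1 : ContDiff ℝ (m : ℕ∞) (deriv (firstOrderProd L g)) :=
      (contDiff_succ_iff_deriv.1 h').2.2
    exact h1.sub (contDiff_const.mul (h'.of_le (by simp)))

theorem HasCompactSupport.firstOrderProd (L : List ℝ) {g : ℝ → ℝ} (hg : HasCompactSupport g) :
    HasCompactSupport (firstOrderProd L g) := by
  induction L with
  | nil => exact hg
  | cons l L ih => exact ih.deriv.sub ih.mul_left

/-- Convexity of |·|^p: its graph lies above the tangent at c. Dividing by |c|^p reduces it to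
Bernoulli's inequality. -/
theorem abs_rpow_tangent_le {p : ℝ} (hp : 1 < p) (c h : ℝ) :
    |c| ^ p + p * |c| ^ (p - 2) * c * (h - c) ≤ |h| ^ p := by
  rcases eq_or_ne c 0 with rfl | hc
  · simp [Real.zero_rpow (by linarith : p ≠ 0)]
    positivity
  · have hc' : 0 < |c| := abs_pos.2 hc
    have hB := one_add_mul_self_le_rpow_one_add (s := |h / c| - 1)
      (by linarith [abs_nonneg (h / c)]) hp.le
    have h1 : 1 + p * (h / c - 1) ≤ |h / c| ^ p := by
      have := le_abs_self (h / c)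
      have : p * (h / c - 1) ≤ p * (|h / c| - 1) := by gcongr
      rw [add_sub_cancel] at hB
      linarith
    have h2 : |h| ^ p = |c| ^ p * |h / c| ^ p := by
      rw [← Real.mul_rpow (abs_nonneg _) (abs_nonneg _), ← abs_mul, mul_div_cancel₀ _ hc]
    have h3 : |c| ^ p = |c| ^ (p - 2) * (c * c) := by
      rw [← abs_mul_abs_self c, ← pow_two, ← Real.rpow_natCast, ← Real.rpow_add hc']
      norm_num
    calc _ = |c| ^ p * (1 + p * (h / c - 1)) := by
          rw [h3]; field_simp
      _ ≤ _ := by rw [h2]; gcongr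

theorem integrable_abs_rpow {p : ℝ} (hp : 1 < p) {v : ℝ → ℝ} (hv : Continuous v)
    (hc : HasCompactSupport v) : Integrable (fun t => |v t| ^ p) := by
  refine Continuous.integrable_of_hasCompactSupport
    (hv.abs.rpow_const fun _ => Or.inr (by linarith)) ?_
  exact hc.comp_left (g := fun y => |y| ^ p) (by simp [Real.zero_rpow (by linarith : p ≠ 0)])

/-- The one-dimensional Hardy inequality for `v' - l v`. -/
theorem hardy_first_order {p : ℝ} (hp : 1 < p) (l : ℝ) {v : ℝ → ℝ} (hv : ContDiff ℝ 1 v)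
    (hc : HasCompactSupport v) :
    |l| ^ p * ∫ t, |v t| ^ p ≤ ∫ t, |deriv v t - l * v t| ^ p := by
  have hw : ContDiff ℝ 1 fun t => |v t| ^ p := by simpa using hv.norm_rpow hp
  have hwc : HasCompactSupport fun t => |v t| ^ p :=
    hc.comp_left (g := fun y => |y| ^ p) (by simp [Real.zero_rpow (by linarith : p ≠ 0)])
  have hwi : Integrable fun t => |v t| ^ p := integrable_abs_rpow hp hv.continuous hc
  have hw'i : Integrable (deriv fun t => |v t| ^ p) :=
    (hw.continuous_deriv le_rfl).integrable_of_hasCompactSupport hwc.deriv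
  have h0 : ∫ t, deriv (fun t => |v t| ^ p) t = 0 :=
    integral_eq_zero_of_hasDerivAt_of_integrable
      (fun t => (hw.differentiable one_ne_zero t).hasDerivAt) hw'i hwi
  have hd : ∀ t, deriv (fun t => |v t| ^ p) t = p * |v t| ^ (p - 2) * v t * deriv v t := fun t =>
    ((hasDerivAt_abs_rpow (v t) hp).comp t (hv.differentiable one_ne_zero t).hasDerivAt).deriv
  -- The tangent is taken at -l v, with increment v'. The linear term is then a constant times
  -- (|v|^p)', whose integral vanishes.
  have hpt : ∀ t, |l| ^ p * |v t| ^ p + (|l| ^ (p - 2) * -l) * deriv (fun t => |v t| ^ p) t ≤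
      |deriv v t - l * v t| ^ p := by
    intro t
    refine le_trans (le_of_eq ?_) (abs_rpow_tangent_le hp (-l * v t) _)
    rw [hd, abs_mul, abs_neg, Real.mul_rpow (abs_nonneg _) (abs_nonneg _),
      Real.mul_rpow (abs_nonneg _) (abs_nonneg _)]
    ring
  have hi : Integrable fun t => |deriv v t - l * v t| ^ p :=
    integrable_abs_rpow hp ((hv.continuous_deriv le_rfl).sub (continuous_const.mul hv.continuous))
      (hc.deriv.sub hc.mul_left)
  have := integral_mono ((hwi.const_mul _).add (hw'i.const_mul _)) hi hpt
  simp only [Pi.add_apply] at this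
  rw [integral_add (hwi.const_mul _) (hw'i.const_mul _), integral_const_mul, integral_const_mul,
    h0] at this
  simpa using this

theorem hardy_firstOrderProd {p : ℝ} (hp : 1 < p) (L : List ℝ) {g : ℝ → ℝ}
    (hg : ContDiff ℝ (L.length : ℕ∞) g) (hc : HasCompactSupport g) :
    |L.prod| ^ p * ∫ t, |g t| ^ p ≤ ∫ t, |firstOrderProd L g t| ^ p := by
  induction L with
  | nil => simp [firstOrderProd]
  | cons l L ih =>
    have h1 : ContDiff ℝ 1 (firstOrderProd L g) := by
      have := contDiff_firstOrderProd L 1 (g := g) (by convert hg using 3; simp; ring)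
      simpa using this
    have h2 := ih (hg.of_le (by simp))
    have h3 := hardy_first_order hp l h1 (hc.firstOrderProd L)
    rw [List.prod_cons, abs_mul, Real.mul_rpow (abs_nonneg _) (abs_nonneg _), mul_assoc]
    refine le_trans ?_ h3
    gcongr

/-! ### Optimality by stretching -/

/-- On a stretched function, `firstOrderProd` is a perturbation of the multiplication by the
product of the coefficients. -/
theorem exists_firstOrderProd_stretch (L : List ℝ) {φ : ℝ → ℝ} (hφ : ContDiff ℝ (⊤ : ℕ∞) φ) :
    ∃ F : ℝ × ℝ → ℝ, ContDiff ℝ (⊤ : ℕ∞) F ∧ (∀ s, ∀ τ ∉ tsupport φ, F (s, τ) = 0) ∧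
      (∀ τ, |F (0, τ)| = |L.prod| * |φ τ|) ∧
      ∀ s t, firstOrderProd L (fun t => φ (s * t)) t = F (s, s * t) := by
  induction L with
  | nil =>
    exact ⟨fun z => φ z.2, hφ.comp contDiff_snd, fun s τ h => image_eq_zero_of_notMem_tsupport h,
      by simp, fun s t => rfl⟩
  | cons l L ih =>
    obtain ⟨F, hF, h0, hF0, hFs⟩ := ih
    -- By the chain rule d/dt F(s, st) = s ∂₂F(s, st), so the derivative term drops out at s = 0.
    refine ⟨fun z => z.1 * fderiv ℝ F z (0, 1) - l * F z, ?_, ?_, ?_, ?_⟩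
    · have : ContDiff ℝ (⊤ : ℕ∞) (fderiv ℝ F) := hF.fderiv_right (by simp)
      exact (contDiff_fst.mul (this.clm_apply contDiff_const)).sub (contDiff_const.mul hF)
    · intro s τ hτ
      have : F =ᶠ[nhds (s, τ)] fun _ => 0 := by
        have ho : IsOpen {z : ℝ × ℝ | z.2 ∉ tsupport φ} :=
          (isClosed_tsupport φ).isOpen_compl.preimage continuous_snd
        filter_upwards [ho.mem_nhds (show (s, τ).2 ∉ tsupport φ from hτ)] with z hz
        exact h0 z.1 z.2 hz
      simp [this.fderiv_eq, h0 s τ hτ]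
    · intro τ
      simp [abs_mul, hF0, mul_assoc]
    · intro s t
      have hfun : firstOrderProd L (fun t => φ (s * t)) = fun t => F (s, s * t) :=
        funext (hFs s)
      have hd : HasDerivAt (fun t => F (s, s * t)) (fderiv ℝ F (s, s * t) (0, s)) t := by
        have h1 : HasDerivAt (fun t : ℝ => (s, s * t)) ((0 : ℝ), s) t := by
          simpa using (hasDerivAt_const t s).prodMk ((hasDerivAt_id t).const_mul s)
        exact (hF.differentiable (by simp) (s, s * t)).hasFDerivAt.comp_hasDerivAt t h1
      have h2 : ((0 : ℝ), s) = s • ((0 : ℝ), (1 : ℝ)) := by simp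
      simp only [firstOrderProd, hfun, hd.deriv]
      rw [h2, map_smul, smul_eq_mul]

theorem continuous_integral_abs_rpow {p : ℝ} (hp : 1 < p) {F : ℝ × ℝ → ℝ} (hF : Continuous F)
    {K : Set ℝ} (hK : IsCompact K) (h0 : ∀ s, ∀ τ ∉ K, F (s, τ) = 0) :
    Continuous fun s => ∫ τ, |F (s, τ)| ^ p := by
  have h : (fun s => ∫ τ, |F (s, τ)| ^ p) = fun s => ∫ τ in K, |F (s, τ)| ^ p := by
    funext s
    rw [setIntegral_eq_integral_of_forall_compl_eq_zero]
    intro τ hτ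
    simp [h0 s τ hτ, Real.zero_rpow (by linarith : p ≠ 0)]
  rw [h]
  refine continuous_parametric_integral_of_continuous ?_ hK
  exact hF.abs.rpow_const fun _ => Or.inr (by linarith)

/-- The constant in `hardy_firstOrderProd` is optimal. -/
theorem le_of_firstOrderProd_le {p : ℝ} (hp : 1 < p) (L : List ℝ) {c : ℝ}
    (h : ∀ g : ℝ → ℝ, ContDiff ℝ (⊤ : ℕ∞) g → HasCompactSupport g →
      c * ∫ t, |g t| ^ p ≤ ∫ t, |firstOrderProd L g t| ^ p) :
    c ≤ |L.prod| ^ p := by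
  let φ : ContDiffBump (0 : ℝ) := ⟨1, 2, one_pos, one_lt_two⟩
  have hφ : ContDiff ℝ (⊤ : ℕ∞) φ := φ.contDiff
  obtain ⟨F, hF, h0, hF0, hFs⟩ := exists_firstOrderProd_stretch L hφ
  have hcont := continuous_integral_abs_rpow hp hF.continuous φ.hasCompactSupport h0
  -- The substitution τ = st puts the same factor s⁻¹ on both sides.
  have hle : ∀ s : ℝ, 0 < s → c * ∫ t, |φ t| ^ p ≤ ∫ τ, |F (s, τ)| ^ p := by
    intro s hs
    have h1 := h (fun t => φ (s * t)) (hφ.comp (contDiff_const.mul contDiff_id)) (by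
      exact φ.hasCompactSupport.comp_homeomorph (Homeomorph.mulLeft₀ s hs.ne'))
    simp only [hFs] at h1
    rw [Measure.integral_comp_mul_left (fun t => |φ t| ^ p) s,
      Measure.integral_comp_mul_left (fun t => |F (s, t)| ^ p) s, smul_eq_mul, smul_eq_mul,
      mul_left_comm] at h1
    exact le_of_mul_le_mul_left h1 (by positivity)
  have hlim : c * ∫ t, |φ t| ^ p ≤ ∫ τ, |F (0, τ)| ^ p := by
    refine ge_of_tendsto ((hcont.tendsto 0).mono_left (nhdsWithin_le_nhds (s := Set.Ioi 0))) ?_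
    filter_upwards [self_mem_nhdsWithin] with s hs using hle s hs
  have hpos : 0 < ∫ t, |φ t| ^ p := by
    refine Continuous.integral_pos_of_hasCompactSupport_nonneg_nonzero
      (φ.continuous.abs.rpow_const fun _ => Or.inr (by linarith)) ?_ (fun t => by positivity)
      (x := 0) ?_
    · exact φ.hasCompactSupport.comp_left (g := fun y => |y| ^ p)
        (by simp [Real.zero_rpow (by linarith : p ≠ 0)])
    · have : φ 0 = 1 := φ.one_of_mem_closedBall (by simp [φ])
      simp [this]
  simp only [hF0, Real.mul_rpow (abs_nonneg _) (abs_nonneg _), integral_const_mul] at hlim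
  exact le_of_mul_le_mul_right hlim hpos

/-! ### Radial calculus in the variable log|x| -/

/-- Writing |x|^{-2} as an exponential of log|x| keeps the coefficient of x a function of log|x|, so
the lemma can be applied again for second derivatives. -/
theorem hasFDerivAt_comp_log_norm {E : Type*} [NormedAddCommGroup E] [InnerProductSpace ℝ E]
    {q : ℝ → ℝ} {q' : ℝ} {x : E} (hx : x ≠ 0) (hq : HasDerivAt q q' (Real.log ‖x‖)) :
    HasFDerivAt (fun y => q (Real.log ‖y‖)) ((Real.exp (-2 * Real.log ‖x‖) * q') • innerSL ℝ x)
      x := by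
  have hx' : 0 < ‖x‖ := norm_pos_iff.2 hx
  have h1 : HasFDerivAt (fun y : E => ‖y‖ ^ 2) (2 • innerSL ℝ x) x :=
    (hasStrictFDerivAt_norm_sq x).hasFDerivAt
  have h2 := (h1.log (by positivity)).const_mul (1 / 2 : ℝ)
  have h3 : (fun y : E => 1 / 2 * Real.log (‖y‖ ^ 2)) = fun y => Real.log ‖y‖ := by
    funext y
    rw [Real.log_pow]
    push_cast
    ring
  rw [h3] at h2
  have h4 := hq.comp_hasFDerivAt x h2
  refine h4.congr_fderiv ?_
  have h5 : Real.exp (-2 * Real.log ‖x‖) = (‖x‖ ^ 2)⁻¹ := by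
    rw [neg_mul, Real.exp_neg, two_mul, Real.exp_add, Real.exp_log hx', pow_two]
  rw [h5]
  ext y
  simp
  ring

theorem fderiv_of_radial {E : Type*} [NormedAddCommGroup E] [InnerProductSpace ℝ E]
    {u : E → ℝ} {U : ℝ → ℝ} (hu : ∀ x ≠ 0, u x = U (Real.log ‖x‖)) (hU : Differentiable ℝ U)
    {x : E} (hx : x ≠ 0) :
    fderiv ℝ u x = (Real.exp (-2 * Real.log ‖x‖) * deriv U (Real.log ‖x‖)) • innerSL ℝ x := by
  have he : u =ᶠ[nhds x] fun y => U (Real.log ‖y‖) := by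
    filter_upwards [isOpen_ne.mem_nhds hx] with y hy using hu y hy
  rw [he.fderiv_eq]
  exact (hasFDerivAt_comp_log_norm hx (hU _).hasDerivAt).fderiv

theorem norm_gradient_of_radial {E : Type*} [NormedAddCommGroup E] [InnerProductSpace ℝ E]
    [CompleteSpace E] {u : E → ℝ} {U : ℝ → ℝ} (hu : ∀ x ≠ 0, u x = U (Real.log ‖x‖))
    (hU : Differentiable ℝ U) {x : E} (hx : x ≠ 0) :
    ‖gradient u x‖ = Real.exp (-Real.log ‖x‖) * |deriv U (Real.log ‖x‖)| := by
  have hx' : 0 < ‖x‖ := norm_pos_iff.2 hx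
  rw [gradient, LinearIsometryEquiv.norm_map, fderiv_of_radial hu hU hx, norm_smul,
    innerSL_apply_norm, Real.norm_eq_abs, abs_mul, abs_of_pos (Real.exp_pos _), neg_mul,
    Real.exp_neg, Real.exp_neg, two_mul, Real.exp_add, Real.exp_log hx']
  field_simp

/-- The first derivative is q(log|y|)⟨y,·⟩ with q = e^{-2s}U'. Taking the trace of its derivative
gives q' from the radial part (as e^{-2t}|x|² = 1) and nq from the identity. -/
theorem laplacian_of_radial {n : ℕ} {u : EuclideanSpace ℝ (Fin n) → ℝ} {U : ℝ → ℝ}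
    (hu : ∀ x ≠ 0, u x = U (Real.log ‖x‖)) (hU : Differentiable ℝ U)
    (hU' : Differentiable ℝ (deriv U)) {x : EuclideanSpace ℝ (Fin n)} (hx : x ≠ 0) :
    Laplacian.laplacian u x = Real.exp (-2 * Real.log ‖x‖) *
      (deriv (deriv U) (Real.log ‖x‖) + (n - 2) * deriv U (Real.log ‖x‖)) := by
  have hx' : 0 < ‖x‖ := norm_pos_iff.2 hx
  set t := Real.log ‖x‖ with ht
  let B : EuclideanSpace ℝ (Fin n) →L[ℝ] EuclideanSpace ℝ (Fin n) →L[ℝ] ℝ := innerSL ℝ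
  have hB : ∀ y z, B y z = inner ℝ y z := fun _ _ => rfl
  have he : fderiv ℝ u =ᶠ[nhds x] fun y =>
      (fun s => Real.exp (-2 * s) * deriv U s) (Real.log ‖y‖) • B y := by
    filter_upwards [isOpen_ne.mem_nhds hx] with y hy using
      fderiv_of_radial hu hU hy
  have hq : HasDerivAt (fun s => Real.exp (-2 * s) * deriv U s)
      (Real.exp (-2 * t) * (deriv (deriv U) t - 2 * deriv U t)) t := by
    have h1 : HasDerivAt (fun s : ℝ => Real.exp (-2 * s)) (Real.exp (-2 * t) * (-2 * 1)) t :=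
      ((hasDerivAt_id t).const_mul (-2)).exp
    refine (h1.mul (hU' t).hasDerivAt).congr_deriv ?_
    ring
  have h2 := (hasFDerivAt_comp_log_norm hx hq).smul (B.hasFDerivAt (x := x))
  rw [InnerProductSpace.laplacian_eq_iteratedFDeriv_orthonormalBasis u
    (EuclideanSpace.basisFun (Fin n) ℝ)]
  simp only [iteratedFDeriv_two_apply, he.fderiv_eq.trans h2.fderiv]
  have hsum : ∑ i, x i * x i = ‖x‖ ^ 2 := by
    rw [EuclideanSpace.norm_sq_eq]
    simp [pow_two]
  have hexp : Real.exp (-2 * t) * ‖x‖ ^ 2 = 1 := by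
    rw [neg_mul, Real.exp_neg, two_mul, Real.exp_add, Real.exp_log hx']
    field_simp
  have hsum' : ∑ i, Real.exp (-2 * t) * (Real.exp (-2 * t) *
      (deriv (deriv U) t - 2 * deriv U t)) * x i * x i =
      Real.exp (-2 * t) * (deriv (deriv U) t - 2 * deriv U t) := by
    simp_rw [mul_assoc _ (x _) (x _), ← Finset.mul_sum, hsum]
    linear_combination (Real.exp (-2 * t) * (deriv (deriv U) t - 2 * deriv U t)) * hexp
  simp only [neg_mul] at hsum'
  simp [hB, EuclideanSpace.inner_single_right, Finset.sum_add_distrib, ← ht,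
    hsum']
  ring

/-- Polar coordinates with r = e^t: r^{n-1} dr = e^{nt} dt absorbs the factor e^{-nt}. -/
theorem radial_integrable_iff {n : ℕ} (hn : n ≠ 0) {f : EuclideanSpace ℝ (Fin n) → ℝ}
    {Φ : ℝ → ℝ} (hf : ∀ x ≠ 0, f x = Real.exp (-n * Real.log ‖x‖) * Φ (Real.log ‖x‖)) :
    (Integrable f ↔ Integrable Φ) ∧ ∫ x, f x =
      (n * volume.real (Metric.ball (0 : EuclideanSpace ℝ (Fin n)) 1)) * ∫ t, Φ t := by
  have : NeZero n := ⟨hn⟩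
  have hae : f =ᵐ[volume] fun x =>
      (fun r => Real.exp (-n * Real.log r) * Φ (Real.log r)) ‖x‖ := by
    filter_upwards [Measure.ae_ne volume (0 : EuclideanSpace ℝ (Fin n))] with x hx using hf x hx
  set q : ℝ → ℝ := fun r => Real.exp (-n * Real.log r) * Φ (Real.log r) with hq
  have himg : Real.exp '' Set.univ = Set.Ioi 0 := by rw [Set.image_univ, Real.range_exp]
  have hd : ∀ t ∈ Set.univ, HasDerivWithinAt Real.exp (Real.exp t) Set.univ t :=
    fun t _ => (Real.hasDerivAt_exp t).hasDerivWithinAt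
  have hcongr : (fun t => |Real.exp t| • (Real.exp t ^ (n - 1) • q (Real.exp t))) = Φ := by
    funext t
    simp only [hq]
    rw [abs_of_pos (Real.exp_pos t), Real.log_exp, smul_eq_mul, smul_eq_mul, ← mul_assoc,
      ← pow_succ', Nat.sub_add_cancel (Nat.pos_of_ne_zero hn), ← Real.exp_nat_mul, ← mul_assoc,
      ← Real.exp_add]
    simp
  constructor
  · rw [integrable_congr hae, integrable_fun_norm_addHaar volume (f := q),
      finrank_euclideanSpace_fin, ← himg,
      integrableOn_image_iff_integrableOn_abs_deriv_smul MeasurableSet.univ hd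
        Real.exp_injective.injOn, hcongr, integrableOn_univ]
  · rw [integral_congr_ae hae, integral_fun_norm_addHaar volume q,
      finrank_euclideanSpace_fin, ← himg,
      integral_image_eq_integral_abs_deriv_smul MeasurableSet.univ hd
        Real.exp_injective.injOn, hcongr, setIntegral_univ]
    simp [mul_assoc]

/-! ### Factorisation of the iterated operators -/

/-- The coefficients of the first order factors of `Δ^m`, conjugated by powers of `|x|`. -/
noncomputable def laplacianCoeffs (n : ℕ) (β : ℝ) : ℕ → List ℝ
  | 0 => []
  | j + 1 => (β + 2 * j) :: (β + 2 * j + 2 - n) :: laplacianCoeffs n β j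

theorem length_laplacianCoeffs (n : ℕ) (β : ℝ) (j : ℕ) :
    (laplacianCoeffs n β j).length = 2 * j := by
  induction j with
  | zero => rfl
  | succ j ih => simp [laplacianCoeffs, ih]; ring

theorem deriv_exp_mul {G : ℝ → ℝ} (hG : Differentiable ℝ G) (b : ℝ) :
    deriv (fun t => Real.exp (-b * t) * G t) =
      fun t => Real.exp (-b * t) * (deriv G t - b * G t) := by
  funext t
  have h1 : HasDerivAt (fun s : ℝ => Real.exp (-b * s)) (Real.exp (-b * t) * (-b * 1)) t :=
    ((hasDerivAt_id t).const_mul (-b)).exp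
  refine ((h1.mul (hG t).hasDerivAt).congr_deriv ?_).deriv
  ring

theorem differentiable_firstOrderProd {L : List ℝ} {k : ℕ} (hL : L.length + 1 ≤ k) {g : ℝ → ℝ}
    (hg : ContDiff ℝ (k : ℕ∞) g) : Differentiable ℝ (firstOrderProd L g) := by
  refine (contDiff_firstOrderProd L 1 (hg.of_le ?_)).differentiable (by simp)
  exact_mod_cast (by omega : 1 + L.length ≤ k)

/-- Radially Δ = e^{-2t} D(D + n - 2), and passing e^{-bt} through replaces D by D - b. This yields
the factors D - b and D - (b + 2 - n), while b grows by 2. -/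
theorem iterate_laplacian_of_radial {n k : ℕ} {u : EuclideanSpace ℝ (Fin n) → ℝ} {g : ℝ → ℝ}
    (β : ℝ) (hg : ContDiff ℝ (k : ℕ∞) g)
    (hu : ∀ x ≠ 0, u x = Real.exp (-β * Real.log ‖x‖) * g (Real.log ‖x‖)) (j : ℕ)
    (hj : 2 * j ≤ k) : ∀ x ≠ 0, Laplacian.laplacian^[j] u x =
      Real.exp (-(β + 2 * j) * Real.log ‖x‖) *
        firstOrderProd (laplacianCoeffs n β j) g (Real.log ‖x‖) := by
  induction j with
  | zero => simpa [laplacianCoeffs, firstOrderProd] using hu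
  | succ j ih =>
    intro x hx
    set b : ℝ := β + 2 * j with hb
    set G := firstOrderProd (laplacianCoeffs n β j) g with hGdef
    have hlen := length_laplacianCoeffs n β j
    have hG : Differentiable ℝ G := differentiable_firstOrderProd (by omega) hg
    have hG1 : Differentiable ℝ (fun t => deriv G t - b * G t) :=
      differentiable_firstOrderProd (L := b :: laplacianCoeffs n β j)
        (by simp only [List.length_cons]; omega) hg
    have hG' : Differentiable ℝ (deriv G) := by
      have := hG1.add (hG.const_mul b)
      simpa [Pi.add_def] using this
    have hexp : Differentiable ℝ fun t : ℝ => Real.exp (-b * t) := by fun_prop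
    have hd := deriv_exp_mul hG b
    have hV : Differentiable ℝ fun t => Real.exp (-b * t) * G t := hexp.mul hG
    rw [Function.iterate_succ_apply', laplacian_of_radial (ih (by omega)) hV
      (by rw [hd]; exact hexp.mul hG1) hx, hd, deriv_exp_mul hG1 b]
    set t := Real.log ‖x‖
    simp only [laplacianCoeffs, firstOrderProd, ← hGdef, ← hb]
    have e1 : deriv (fun t => deriv G t - b * G t) t = deriv (deriv G) t - b * deriv G t :=
      ((hG' t).hasDerivAt.sub ((hG t).hasDerivAt.const_mul b)).deriv
    have e2 : deriv (fun t => deriv G t - (b + 2 - n) * G t) t =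
        deriv (deriv G) t - (b + 2 - n) * deriv G t :=
      ((hG' t).hasDerivAt.sub ((hG t).hasDerivAt.const_mul (b + 2 - n))).deriv
    have e3 : Real.exp (-(β + 2 * (j + 1 : ℕ)) * t) = Real.exp (-2 * t) * Real.exp (-b * t) := by
      rw [← Real.exp_add, hb]
      push_cast
      ring_nf
    rw [e1, e2, e3]
    ring

/-- The coefficients of the first order factors of `∇^k`, conjugated by powers of `|x|`. -/
noncomputable def nablaCoeffs (n : ℕ) (β : ℝ) (k : ℕ) : List ℝ :=
  if Even k then laplacianCoeffs n β (k / 2)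
  else (β + 2 * (k / 2 : ℕ)) :: laplacianCoeffs n β (k / 2)

theorem length_nablaCoeffs (n : ℕ) (β : ℝ) (k : ℕ) : (nablaCoeffs n β k).length = k := by
  unfold nablaCoeffs
  split_ifs with h
  · rw [length_laplacianCoeffs, Nat.two_mul_div_two_of_even h]
  · rw [List.length_cons, length_laplacianCoeffs,
      Nat.two_mul_div_two_add_one_of_odd (Nat.not_even_iff_odd.1 h)]

theorem nablaPowNorm_of_radial {n k : ℕ} {u : EuclideanSpace ℝ (Fin n) → ℝ} {g : ℝ → ℝ}
    (β : ℝ) (hg : ContDiff ℝ (k : ℕ∞) g)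
    (hu : ∀ x ≠ 0, u x = Real.exp (-β * Real.log ‖x‖) * g (Real.log ‖x‖))
    {x : EuclideanSpace ℝ (Fin n)} (hx : x ≠ 0) :
    nablaPowNorm k u x = Real.exp (-(β + k) * Real.log ‖x‖) *
      |firstOrderProd (nablaCoeffs n β k) g (Real.log ‖x‖)| := by
  have hlap := iterate_laplacian_of_radial β hg hu (k / 2) (by omega)
  unfold nablaPowNorm nablaCoeffs
  split_ifs with h
  · have hk : ((k : ℕ) : ℝ) = 2 * (k / 2 : ℕ) := by
      exact_mod_cast (Nat.two_mul_div_two_of_even h).symm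
    rw [hlap x hx, abs_mul, abs_of_pos (Real.exp_pos _), ← hk]
  · have hk' := Nat.two_mul_div_two_add_one_of_odd (Nat.not_even_iff_odd.1 h)
    have hk : ((k : ℕ) : ℝ) = 2 * (k / 2 : ℕ) + 1 := by exact_mod_cast hk'.symm
    have hG : Differentiable ℝ (firstOrderProd (laplacianCoeffs n β (k / 2)) g) :=
      differentiable_firstOrderProd (by rw [length_laplacianCoeffs]; omega) hg
    have hexp : Differentiable ℝ fun t : ℝ => Real.exp (-(β + 2 * (k / 2 : ℕ)) * t) := by
      fun_prop
    have hV : Differentiable ℝ fun t => Real.exp (-(β + 2 * (k / 2 : ℕ)) * t) *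
      firstOrderProd (laplacianCoeffs n β (k / 2)) g t := hexp.mul hG
    rw [norm_gradient_of_radial hlap hV hx, deriv_exp_mul hG, abs_mul,
      abs_of_pos (Real.exp_pos _), ← mul_assoc, ← Real.exp_add, firstOrderProd]
    congr 2
    rw [hk]
    ring

theorem norm_rpow_mul_exp_mul_rpow {E : Type*} [NormedAddCommGroup E] {x : E} (hx : x ≠ 0)
    {y : ℝ} (hy : 0 ≤ y) (a b p : ℝ) :
    ‖x‖ ^ a * (Real.exp (-b * Real.log ‖x‖) * y) ^ p =
      Real.exp ((a - b * p) * Real.log ‖x‖) * y ^ p := by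
  rw [Real.mul_rpow (Real.exp_pos _).le hy, ← Real.exp_mul,
    Real.rpow_def_of_pos (norm_pos_iff.2 hx), ← mul_assoc, ← Real.exp_add]
  ring_nf

theorem rellichLHS_of_radial {n k : ℕ} {u : EuclideanSpace ℝ (Fin n) → ℝ} {g : ℝ → ℝ}
    {α β p : ℝ} (hβ : (β + k) * p = n + α) (hg : ContDiff ℝ (k : ℕ∞) g)
    (hu : ∀ x ≠ 0, u x = Real.exp (-β * Real.log ‖x‖) * g (Real.log ‖x‖)) :
    ∀ x ≠ 0, rellichLHS α p k u x = Real.exp (-n * Real.log ‖x‖) *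
      |firstOrderProd (nablaCoeffs n β k) g (Real.log ‖x‖)| ^ p := by
  intro x hx
  rw [rellichLHS, nablaPowNorm_of_radial β hg hu hx,
    norm_rpow_mul_exp_mul_rpow hx (abs_nonneg _), hβ]
  ring_nf

theorem rellichRHS_of_radial {n k : ℕ} {u : EuclideanSpace ℝ (Fin n) → ℝ} {g : ℝ → ℝ}
    {α β p : ℝ} (hβ : (β + k) * p = n + α)
    (hu : ∀ x ≠ 0, u x = Real.exp (-β * Real.log ‖x‖) * g (Real.log ‖x‖)) :
    ∀ x ≠ 0, rellichRHS α p k u x = Real.exp (-n * Real.log ‖x‖) *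
      |g (Real.log ‖x‖)| ^ p := by
  intro x hx
  rw [rellichRHS, hu x hx, abs_mul, abs_of_pos (Real.exp_pos _),
    norm_rpow_mul_exp_mul_rpow hx (abs_nonneg _)]
  congr 3
  linarith

/-! ### Radial functions and their profiles -/

theorem exists_profile_of_mem_radialCc {n k : ℕ} (hn : n ≠ 0) (β : ℝ)
    {u : EuclideanSpace ℝ (Fin n) → ℝ} (hu : u ∈ radialCc n k) :
    ∃ g : ℝ → ℝ, ContDiff ℝ (k : ℕ∞) g ∧ HasCompactSupport g ∧
      ∀ x ≠ 0, u x = Real.exp (-β * Real.log ‖x‖) * g (Real.log ‖x‖) := by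
  obtain ⟨hs, hc, h0, hr⟩ := hu
  have : NeZero n := ⟨hn⟩
  obtain ⟨e, he⟩ := exists_norm_eq (EuclideanSpace ℝ (Fin n)) zero_le_one
  have hne : ∀ t : ℝ, ‖Real.exp t • e‖ = Real.exp t := fun t => by
    rw [norm_smul, he, mul_one, Real.norm_of_nonneg (Real.exp_pos t).le]
  refine ⟨fun t => Real.exp (β * t) * u (Real.exp t • e), ?_, ?_, ?_⟩
  · exact (contDiff_const.mul contDiff_id).exp.mul
      (hs.comp (Real.contDiff_exp.smul contDiff_const))
  · obtain ⟨R, hR⟩ := hc.isBounded.subset_closedBall (0 : EuclideanSpace ℝ (Fin n))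
    obtain ⟨ε, hε, hball⟩ := Metric.isOpen_iff.1 (isClosed_tsupport u).isOpen_compl 0 h0
    -- The upper endpoint R suffices because t + 1 ≤ e^t ≤ R, with no need for R > 0.
    refine HasCompactSupport.intro (K := Set.Icc (Real.log ε) R) isCompact_Icc fun t ht => ?_
    suffices Real.exp t • e ∉ tsupport u by
      simp [image_eq_zero_of_notMem_tsupport this]
    intro hmem
    refine ht ⟨?_, ?_⟩
    · by_contra! hlt
      refine hball (?_ : Real.exp t • e ∈ _) hmem
      rw [mem_ball_zero_iff, hne]
      exact (Real.lt_log_iff_exp_lt hε).1 hlt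
    · have := mem_closedBall_zero_iff.1 (hR hmem)
      rw [hne] at this
      linarith [Real.add_one_le_exp t]
  · intro x hx
    have hx' : 0 < ‖x‖ := norm_pos_iff.2 hx
    rw [← mul_assoc, ← Real.exp_add, neg_mul, neg_add_cancel, Real.exp_zero, one_mul]
    exact hr _ _ (by rw [hne, Real.exp_log hx'])

theorem exists_mem_radialCc_of_profile {n : ℕ} (k : ℕ) (β : ℝ) {g : ℝ → ℝ}
    (hg : ContDiff ℝ (⊤ : ℕ∞) g) (hc : HasCompactSupport g) :
    ∃ u ∈ radialCc n k, ∀ x ≠ 0, u x = Real.exp (-β * Real.log ‖x‖) * g (Real.log ‖x‖) := by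
  classical
  obtain ⟨M, hM⟩ := hc.isBounded.subset_closedBall (0 : ℝ)
  have hgM : ∀ t, M < |t| → g t = 0 := fun t ht => by
    refine image_eq_zero_of_notMem_tsupport fun hmem => ?_
    have := mem_closedBall_zero_iff.1 (hM hmem)
    rw [Real.norm_eq_abs] at this
    linarith
  -- The origin needs its own case: `Real.log 0 = 0` would give the value g 0 there.
  let u : EuclideanSpace ℝ (Fin n) → ℝ := fun x =>
    if x = 0 then 0 else Real.exp (-β * Real.log ‖x‖) * g (Real.log ‖x‖)
  have hu : ∀ x ≠ 0, u x = Real.exp (-β * Real.log ‖x‖) * g (Real.log ‖x‖) := fun x hx =>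
    if_neg hx
  have hsmall : ∀ x : EuclideanSpace ℝ (Fin n), ‖x‖ < Real.exp (-M) → u x = 0 := by
    intro x hx
    rcases eq_or_ne x 0 with rfl | h
    · exact if_pos rfl
    · rw [hu x h, hgM, mul_zero]
      have := (Real.log_lt_iff_lt_exp (norm_pos_iff.2 h)).2 hx
      exact lt_of_lt_of_le (by linarith) (neg_le_abs _)
  have hzero : u =ᶠ[nhds 0] fun _ => 0 := by
    filter_upwards [Metric.ball_mem_nhds 0 (Real.exp_pos (-M))] with x hx
    exact hsmall x (mem_ball_zero_iff.1 hx)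
  refine ⟨u, ⟨?_, ?_, ?_, ?_⟩, hu⟩
  · rw [contDiff_iff_contDiffAt]
    intro x
    rcases eq_or_ne x 0 with rfl | h
    · exact contDiffAt_const.congr_of_eventuallyEq hzero
    · have hlog : ContDiffAt ℝ (k : ℕ∞) (fun y : EuclideanSpace ℝ (Fin n) => Real.log ‖y‖) x :=
        (contDiffAt_norm ℝ h).log (norm_ne_zero_iff.2 h)
      have hgk : ContDiff ℝ (k : ℕ∞) g := hg.of_le (by exact_mod_cast le_top)
      refine (((contDiffAt_const (c := -β)).mul hlog).exp.mul
        (hgk.contDiffAt.comp x hlog)).congr_of_eventuallyEq ?_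
      filter_upwards [isOpen_ne.mem_nhds h] with y hy using hu y hy
  · refine HasCompactSupport.intro (isCompact_closedBall 0 (Real.exp M)) fun x hx => ?_
    rw [mem_closedBall_zero_iff, not_le] at hx
    have hx0 : 0 < ‖x‖ := (Real.exp_pos M).trans hx
    rw [hu x (norm_pos_iff.1 hx0), hgM, mul_zero]
    exact lt_of_lt_of_le ((Real.lt_log_iff_exp_lt hx0).2 hx) (le_abs_self _)
  · exact notMem_tsupport_iff_eventuallyEq.2 hzero
  · intro x y hxy
    have h0 : x = 0 ↔ y = 0 := by rw [← norm_eq_zero, hxy, norm_eq_zero]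
    simp only [u, h0, hxy]

/-! ### Integrability and the best constant -/

theorem integrable_rellich {n k : ℕ} (hn : n ≠ 0) {α p : ℝ} (hp : 1 < p)
    {u : EuclideanSpace ℝ (Fin n) → ℝ} (hu : u ∈ radialCc n k) :
    Integrable (rellichLHS α p k u) ∧ Integrable (rellichRHS α p k u) := by
  have hβ : ((n + α) / p - k + k) * p = n + α := by
    rw [sub_add_cancel, div_mul_cancel₀ _ (by linarith)]
  set β := (n + α) / p - k
  obtain ⟨g, hg, hc, hug⟩ := exists_profile_of_mem_radialCc hn β hu
  refine ⟨(radial_integrable_iff hn (f := rellichLHS α p k u)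
      (Φ := fun t => |firstOrderProd (nablaCoeffs n β k) g t| ^ p)
      (rellichLHS_of_radial hβ hg hug)).1.2 ?_,
    (radial_integrable_iff hn (f := rellichRHS α p k u)
      (Φ := fun t => |g t| ^ p) (rellichRHS_of_radial hβ hug)).1.2 ?_⟩
  · refine integrable_abs_rpow hp ?_ (hc.firstOrderProd _)
    exact (contDiff_firstOrderProd _ 0 (by simpa [length_nablaCoeffs] using hg)).continuous
  · exact integrable_abs_rpow hp hg.continuous hc

theorem isBestRellichConst_prod_nablaCoeffs {n k : ℕ} (hn : n ≠ 0) (α : ℝ) {p : ℝ}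
    (hp : 1 < p) :
    IsBestRellichConst n k α p (|(nablaCoeffs n ((n + α) / p - k) k).prod| ^ p) := by
  set β := (n + α) / p - k with hβdef
  have hβ : (β + k) * p = n + α := by
    rw [hβdef, sub_add_cancel, div_mul_cancel₀ _ (by linarith)]
  have hC : 0 < n * volume.real (Metric.ball (0 : EuclideanSpace ℝ (Fin n)) 1) := by
    have : 0 < (n : ℝ) := by exact_mod_cast Nat.pos_of_ne_zero hn
    have : 0 < volume.real (Metric.ball (0 : EuclideanSpace ℝ (Fin n)) 1) :=
      ENNReal.toReal_pos (Metric.measure_ball_pos _ _ one_pos).ne' measure_ball_lt_top.ne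
    positivity
  constructor
  · intro u hu
    obtain ⟨g, hg, hc, hug⟩ := exists_profile_of_mem_radialCc hn β hu
    rw [(radial_integrable_iff hn (f := rellichLHS α p k u)
      (Φ := fun t => |firstOrderProd (nablaCoeffs n β k) g t| ^ p)
      (rellichLHS_of_radial hβ hg hug)).2,
      (radial_integrable_iff hn (f := rellichRHS α p k u)
      (Φ := fun t => |g t| ^ p) (rellichRHS_of_radial hβ hug)).2, mul_left_comm]
    refine mul_le_mul_of_nonneg_left (hardy_firstOrderProd hp _ ?_ hc) hC.le
    rwa [length_nablaCoeffs]
  · intro c hcmem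
    refine le_of_firstOrderProd_le hp _ fun g hg hc => ?_
    obtain ⟨u, hu, hug⟩ := exists_mem_radialCc_of_profile (n := n) k β hg hc
    have hgk : ContDiff ℝ (k : ℕ∞) g := hg.of_le (by exact_mod_cast le_top)
    have := hcmem u hu
    rw [(radial_integrable_iff hn (f := rellichLHS α p k u)
      (Φ := fun t => |firstOrderProd (nablaCoeffs n β k) g t| ^ p)
      (rellichLHS_of_radial hβ hgk hug)).2,
      (radial_integrable_iff hn (f := rellichRHS α p k u)
      (Φ := fun t => |g t| ^ p) (rellichRHS_of_radial hβ hug)).2, mul_left_comm] at this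
    exact le_of_mul_le_mul_left this hC

/-- With h = 2(m - i) + ε, the i-th pair of coefficients multiplies to -γ_{α,h}; ε carries the
parity of k. -/
theorem abs_prod_laplacianCoeffs_rpow (n : ℕ) (α p : ℝ) (m ε : ℕ) :
    |(laplacianCoeffs n ((n + α) / p - (2 * m + ε : ℕ)) m).prod| ^ p =
      ∏ h ∈ Finset.Icc 1 m, |rellichGamma n α p (2 * h + ε)| ^ p := by
  have hprod : ∀ β j, (laplacianCoeffs n β j).prod =
      ∏ i ∈ Finset.range j, (β + 2 * i) * (β + 2 * i + 2 - n) := by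
    intro β j
    induction j with
    | zero => simp [laplacianCoeffs]
    | succ j ih =>
      rw [Finset.prod_range_succ, laplacianCoeffs, List.prod_cons, List.prod_cons, ih]
      ring
  rw [hprod, Finset.abs_prod, ← Real.finsetProd_rpow _ _ fun _ _ => abs_nonneg _]
  refine Finset.prod_nbij' (fun i => m - i) (fun h => m - h) ?_ ?_ ?_ ?_ ?_
  · simp only [Finset.mem_range, Finset.mem_Icc]; omega
  · simp only [Finset.mem_range, Finset.mem_Icc]; omega
  · simp only [Finset.mem_range]; omega
  · simp only [Finset.mem_Icc]; omega
  · intro i hi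
    rw [rellichGamma, ← abs_neg]
    have him : i ≤ m := (Finset.mem_range.1 hi).le
    congr 2
    push_cast [Nat.cast_sub him]
    ring

theorem theorem1p1 (n k : ℕ) (hn : 2 ≤ n) (hk : 2 ≤ k) (α p : ℝ) (hp : 1 < p) :
    (∀ u ∈ radialCc n k,
      Integrable (rellichLHS α p k u) ∧ Integrable (rellichRHS α p k u)) ∧
    (∀ m : ℕ, k = 2 * m →
      IsBestRellichConst n k α p
        (∏ h ∈ Finset.Icc 1 m, |rellichGamma n α p (2 * h)| ^ p)) ∧
    (∀ m : ℕ, k = 2 * m + 1 →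
      IsBestRellichConst n k α p
        (|hardyH n α p| ^ p *
          ∏ h ∈ Finset.Icc 1 m, |rellichGamma n α p (2 * h + 1)| ^ p)) := by
  have hn0 : n ≠ 0 := by omega
  refine ⟨fun u hu => integrable_rellich hn0 hp hu, ?_, ?_⟩
  · rintro m rfl
    have h := isBestRellichConst_prod_nablaCoeffs (k := 2 * m) hn0 α hp
    have h' := abs_prod_laplacianCoeffs_rpow n α p m 0
    simp only [add_zero] at h'
    rwa [nablaCoeffs, if_pos (even_two_mul m), Nat.mul_div_cancel_left _ two_pos, h'] at h
  · rintro m rfl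
    have h := isBestRellichConst_prod_nablaCoeffs (k := 2 * m + 1) hn0 α hp
    have hodd : ¬ Even (2 * m + 1) := Nat.not_even_iff_odd.2 (odd_two_mul_add_one m)
    have hdiv : (2 * m + 1) / 2 = m := by omega
    -- The coefficient of the outer gradient factor is β + 2m.
    have hH : (n + α) / p - (2 * m + 1 : ℕ) + 2 * m = hardyH n α p := by
      rw [hardyH]
      push_cast
      ring
    rwa [nablaCoeffs, if_neg hodd, hdiv, List.prod_cons, abs_mul,
      Real.mul_rpow (abs_nonneg _) (abs_nonneg _), abs_prod_laplacianCoeffs_rpow, hH] at h
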